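/- Let $n\ge 0$, let $[n]=\{1,\dots,n\}$, and let $\mathcal S_n$ be the set of permutations $\pi=a_1a_2\cdots a_n$ of $[n]$ in one-line notation. A \emph{labeled interval order} on $[n]$ is a partial order $P$ on the set $[n]$ for which there are closed real intervals $[l_z,r_z]$ with $l_z\le r_z$ $(z\in[n])$ such that $x<_P y$ if and only if $r_x<l_y$. For $\pi=a_1\cdots a_n\in\mathcal S_n$ let $$D(\pi)=\{\,i\in[n-1] : a_i>a_{i+1}\,\},\qquad A(\pi)=\{\,a_i : i\in[n-1],\ a_i<a_{i+1}\,\}$$ be its set of descent positions and its set of ascent bottoms, and for $S\subseteq[n-1]$ let $$\boldsymbol\beta_n(S)=\{\pi\in\mathcal S_n : D(\pi)=S\},\qquad \boldsymbol\kappa_n(S)=\{\tau\in\mathcal S_n : A(\tau)\subseteq S\}.$$ (For $n=0$, $[n-1]$ is read as $\emptyset$.) Then the labeled interval orders on $[n]$ are in bijection with the disjoint union $$\bigsqcup_{S\subseteq[n-1]}\boldsymbol\beta_n(S)\times\boldsymbol\kappa_n(S).$$ This set may alternatively be written as $$\{(\pi,\tau)\in\mathcal S_n\times\mathcal S_n :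 A(\tau)\subseteq D(\pi)\};$$ that is, forgetting the index $S$ maps the disjoint union injectively onto this set of pairs, and hence the labeled interval orders on $[n]$ are also in bijection with this set of pairs. -/

import Mathlib

/-- A partial order on `α` is an interval order if every `z` can be assigned a (nonempty) closed
real interval `[l z, r z]` such that `x < y` holds exactly when `[l x, r x]` lies entirely to the
left of `[l y, r y]`. -/
def IsIntervalOrder {α : Type*} (P : PartialOrder α) : Prop :=
  ∃ l r : α → ℝ, (∀ z, l z ≤ r z) ∧ ∀ x y, P.lt x y ↔ r x < l y

/-- Labeled interval orders on `[n]`. The label set `[n] = {1, …, n}` is represented by `Fin n`,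
the label `k + 1` being the element of `Fin n` with value `k`. Two of them are equal exactly when
they are the same order relation (no isomorphisms are factored out). -/
def LabeledIntervalOrder (n : ℕ) : Type :=
  {P : PartialOrder (Fin n) // IsIntervalOrder P}

/-- The set `D(π) ⊆ [n - 1]` of descent positions of `π = a_1 a_2 ⋯ a_n`: the (1-based) positions
`i` with `a_i > a_{i+1}`. Here `p` and `q` are the 0-based names of the positions `i`, `i + 1`. -/
def descentPositions {n : ℕ} (π : Equiv.Perm (Fin n)) : Set ℕ :=
  {i | ∃ p q : Fin n, (p : ℕ) + 1 = i ∧ (q : ℕ) + 1 = i + 1 ∧ π q < π p}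

/-- The set `A(π) ⊆ [n - 1]` of ascent bottoms of `π = a_1 a_2 ⋯ a_n`: the (1-based) values `a_i`
with `a_i < a_{i+1}`. Here `p` and `q` are consecutive positions. -/
def ascentBottoms {n : ℕ} (π : Equiv.Perm (Fin n)) : Set ℕ :=
  {a | ∃ p q : Fin n, (q : ℕ) = (p : ℕ) + 1 ∧ π p < π q ∧ (π p : ℕ) + 1 = a}

/-- The set of permutations of `[n]` whose set of descent positions is `S`. -/
def betaSet (n : ℕ) (S : Set ℕ) : Set (Equiv.Perm (Fin n)) :=
  {π | descentPositions π = S}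

/-- The set of permutations of `[n]` whose set of ascent bottoms is contained in `S`. -/
def kappaSet (n : ℕ) (S : Set ℕ) : Set (Equiv.Perm (Fin n)) :=
  {τ | ascentBottoms τ ⊆ S}

/-- The disjoint union of `betaSet n S × kappaSet n S` over all `S ⊆ [n - 1]`. (For `n = 0` the
index set `[n - 1]` is empty.) -/
def BetaKappa (n : ℕ) : Type :=
  Σ S : {S : Set ℕ // S ⊆ Set.Icc 1 (n - 1)}, betaSet n S.1 × kappaSet n S.1

/-- The map forgetting the index: `(S, (π, τ)) ↦ (π, τ)`. -/
def BetaKappa.toPair {n : ℕ} (x : BetaKappa n) : Equiv.Perm (Fin n) × Equiv.Perm (Fin n) :=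
  (x.2.1.1, x.2.2.1)

/-- The set of pairs `(π, τ)` of permutations of `[n]` with `A(τ) ⊆ D(π)`. -/
def ascentDescentPairs (n : ℕ) : Set (Equiv.Perm (Fin n) × Equiv.Perm (Fin n)) :=
  {p | ascentBottoms p.2 ⊆ descentPositions p.1}

/-! Both sides are matched with pairs `(π, r)`, where `r` is inflationary and `π` descends at every
position outside the image of `r`. Permutations `τ` correspond to inflationary maps `r` whose image
is the complement of `A(τ)` (`exists_perm_equiv_inflationaryMap`); this turns `A(τ) ⊆ D(π)` into the
condition on `(π, r)`. A pair gives the interval order with intervals `[p, r p]` labeled `π p`.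
Conversely, the down-sets of an interval order form a chain; sorting labels by down-set size, ties
by decreasing label, recovers `π`, and the order relation then determines `r`. -/

/-- The values of `τ` that are not ascent bottoms: the descent tops and the last value. -/
def nonAscentBottoms {n : ℕ} (τ : Equiv.Perm (Fin n)) : Set (Fin n) :=
  {v | ∃ p, τ p = v ∧ ∀ q : Fin n, (q : ℕ) = p + 1 → τ q < τ p}

/-- The maps `r : [n] → [n]` with `i ≤ r i` for all `i`. -/
abbrev InflationaryMap (n : ℕ) : Type :=
  {r : Fin n → Fin n // ∀ i, i ≤ r i}

/-! ### Permutations and inflationary maps -/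

/-- The word `0 τ` (with the letters of `τ` shifted up by one), rotated so that it ends in `a`. -/
def rotateCons {n : ℕ} (x : Fin (n + 1) × Equiv.Perm (Fin n)) : Equiv.Perm (Fin (n + 1)) :=
  (Equiv.addRight ((Equiv.Perm.decomposeFin.symm (0, x.2)).symm x.1 + 1)).trans
    (Equiv.Perm.decomposeFin.symm (0, x.2))

theorem rotateCons_apply {n : ℕ} (x : Fin (n + 1) × Equiv.Perm (Fin n)) (p : Fin (n + 1)) :
    rotateCons x p = Equiv.Perm.decomposeFin.symm (0, x.2)
      (p + ((Equiv.Perm.decomposeFin.symm (0, x.2)).symm x.1 + 1)) := rfl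

theorem rotateCons_neg_one {n : ℕ} (x : Fin (n + 1) × Equiv.Perm (Fin n)) :
    rotateCons x (-1) = x.1 := by
  rw [rotateCons_apply, neg_add_eq_sub, add_sub_cancel_right, Equiv.apply_symm_apply]

theorem rotateCons_injective (n : ℕ) : Function.Injective (rotateCons (n := n)) := by
  rintro ⟨a, t⟩ ⟨b, t'⟩ h
  have hab : a = b := by
    have ha := rotateCons_neg_one (a, t)
    rw [h, rotateCons_neg_one] at ha
    exact ha.symm
  subst hab
  set w := Equiv.Perm.decomposeFin.symm ((0 : Fin (n + 1)), t) with hw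
  set w' := Equiv.Perm.decomposeFin.symm ((0 : Fin (n + 1)), t') with hw'
  have happ : ∀ p, w (p + (w.symm a + 1)) = w' (p + (w'.symm a + 1)) := fun p =>
    congrArg (fun e : Equiv.Perm (Fin (n + 1)) => e p) h
  have hk : w.symm a + 1 = w'.symm a + 1 := by
    -- Both words begin with 0, so locating the letter 0 shows that the rotations agree.
    have h0 := happ (-(w.symm a + 1))
    rw [neg_add_cancel] at h0
    have hz : w 0 = w' 0 := by simp [hw, hw']
    rw [hz] at h0
    have := w'.injective h0
    rw [eq_comm, neg_add_eq_zero] at this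
    exact this
  have hww : w = w' := by
    ext1 p
    have := happ (p - (w.symm a + 1))
    rwa [← hk, sub_add_cancel] at this
  have := Equiv.Perm.decomposeFin.symm.injective (hw.symm.trans (hww.trans hw'))
  rw [Prod.mk.injEq] at this
  rw [this.2]

theorem rotateCons_bijective (n : ℕ) : Function.Bijective (rotateCons (n := n)) := by
  rw [Fintype.bijective_iff_injective_and_card]
  refine ⟨rotateCons_injective n, ?_⟩
  simp [Fintype.card_perm, Nat.factorial_succ]

theorem Fin.val_eq_succ_iff_add_one {n : ℕ} {p q : Fin (n + 1)} :
    (q : ℕ) = p + 1 ↔ q = p + 1 ∧ p ≠ Fin.last n := by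
  have hq := q.isLt
  rcases eq_or_ne p (Fin.last n) with rfl | hp
  · simp only [Fin.val_last, ne_eq, not_true_eq_false, and_false, iff_false]
    omega
  · rw [Fin.ext_iff, Fin.val_add_one, if_neg hp]
    simp [hp]

theorem mem_nonAscentBottoms_succ {n : ℕ} {τ : Equiv.Perm (Fin (n + 1))} {v : Fin (n + 1)} :
    v ∈ nonAscentBottoms τ ↔ ∃ p, τ p = v ∧ (p = Fin.last n ∨ τ (p + 1) < τ p) := by
  simp only [nonAscentBottoms, Set.mem_ofPred_eq, Fin.val_eq_succ_iff_add_one]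
  refine exists_congr fun p => and_congr_right fun _ => ?_
  constructor
  · intro h
    by_cases hp : p = Fin.last n
    · exact Or.inl hp
    · exact Or.inr (h _ ⟨rfl, hp⟩)
  · rintro (h | h) q ⟨rfl, hp⟩
    · exact absurd h hp
    · exact h

/-- Rotation preserves the cyclic descents of `0 τ`. Cyclically, 0 is never a descent top, while the
last letter of `τ` is one because 0 follows it. Cutting the cycle after `a` adds `a` as the last
letter. -/
theorem nonAscentBottoms_rotateCons {n : ℕ} (a : Fin (n + 1)) (τ : Equiv.Perm (Fin n)) :
    nonAscentBottoms (rotateCons (a, τ)) = insert a (Fin.succ '' nonAscentBottoms τ) := by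
  have hlast : (Fin.last n) = -1 := by
    rw [eq_neg_iff_add_eq_zero, Fin.last_add_one]
  set w := Equiv.Perm.decomposeFin.symm ((0 : Fin (n + 1)), τ) with hw
  have hw0 : w 0 = 0 := by simp [hw]
  have hws : ∀ j : Fin n, w j.succ = (τ j).succ := fun j => by simp [hw]
  have happ : ∀ p, rotateCons (a, τ) p = w (p + (w.symm a + 1)) := fun p => rfl
  have hstep : ∀ j : Fin n, w (j.succ + 1) < w j.succ ↔
      ∀ q : Fin n, (q : ℕ) = j + 1 → τ q < τ j := by
    intro j
    rw [hws]
    by_cases hj : (j : ℕ) + 1 < n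
    · have : j.succ + 1 = (⟨j + 1, hj⟩ : Fin n).succ := by
        symm
        refine (Fin.val_eq_succ_iff_add_one.1 ?_).1
        simp
      rw [this, hws, Fin.succ_lt_succ_iff]
      constructor
      · intro h q hq
        rwa [show q = ⟨j + 1, hj⟩ from Fin.ext hq]
      · intro h
        exact h _ rfl
    · have : j.succ = Fin.last n := by
        apply Fin.ext
        have := j.isLt
        simp only [Fin.val_succ, Fin.val_last]
        omega
      rw [this, Fin.last_add_one, hw0]
      refine iff_of_true (Fin.succ_pos _) fun q hq => ?_
      have := q.isLt
      omega
  ext v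
  rw [mem_nonAscentBottoms_succ, Set.mem_insert_iff]
  constructor
  · rintro ⟨p, rfl, hp | hp⟩
    · left
      rw [hp, hlast, rotateCons_neg_one]
    · right
      rw [happ, happ, add_right_comm] at hp
      rw [happ]
      generalize p + (w.symm a + 1) = q at hp
      refine Fin.cases ?_ (fun j => ?_) q hp
      · intro h
        rw [hw0] at h
        exact absurd h (Fin.not_lt_zero _)
      · intro h
        exact ⟨τ j, ⟨j, rfl, (hstep j).1 h⟩, (hws j).symm⟩
  · rintro (rfl | ⟨_, ⟨j, rfl, hj⟩, rfl⟩)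
    · exact ⟨Fin.last n, by rw [hlast, rotateCons_neg_one], Or.inl rfl⟩
    · refine ⟨j.succ - (w.symm a + 1), ?_, Or.inr ?_⟩
      · rw [happ, sub_add_cancel, hws]
      · rw [happ, happ, add_right_comm, sub_add_cancel]
        exact (hstep j).2 hj

/-- An inflationary map on `[n + 1]` is an arbitrary first value together with an inflationary map
on the remaining elements. -/
def inflationaryMapSuccEquiv (n : ℕ) :
    Fin (n + 1) × InflationaryMap n ≃ InflationaryMap (n + 1) where
  toFun x := ⟨Fin.cons x.1 fun i => (x.2.1 i).succ, fun i =>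
    Fin.cases (Fin.zero_le _) (fun j => Fin.succ_le_succ_iff.2 (x.2.2 j)) i⟩
  invFun r := (r.1 0, ⟨fun i => (r.1 i.succ).pred
      (Fin.pos_iff_ne_zero.1 ((Fin.succ_pos i).trans_le (r.2 i.succ))), fun i => by
    rw [Fin.le_pred_iff]
    exact r.2 i.succ⟩)
  left_inv x := by simp
  right_inv r := by
    apply Subtype.ext
    funext i
    refine Fin.cases ?_ (fun j => ?_) i <;> simp

theorem range_inflationaryMapSuccEquiv {n : ℕ} (a : Fin (n + 1)) (r : InflationaryMap n) :
    Set.range (inflationaryMapSuccEquiv n (a, r)).1 =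
      insert a (Fin.succ '' Set.range r.1) := by
  change Set.range (Fin.cons a fun i => (r.1 i).succ : Fin (n + 1) → Fin (n + 1)) = _
  rw [Fin.range_cons, ← Set.range_comp]
  rfl

/-- Permutations correspond to inflationary maps in such a way that the values that are not ascent
bottoms become the image. -/
theorem exists_perm_equiv_inflationaryMap (n : ℕ) :
    ∃ φ : Equiv.Perm (Fin n) ≃ InflationaryMap n,
      ∀ τ, Set.range (φ τ).1 = nonAscentBottoms τ := by
  induction n with
  | zero =>
    refine ⟨⟨fun _ => ⟨id, fun i => le_rfl⟩, fun _ => 1, fun _ => Subsingleton.elim _ _,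
      fun _ => Subsingleton.elim _ _⟩, fun τ => ?_⟩
    ext v
    exact v.elim0
  | succ n ih =>
    obtain ⟨φ, hφ⟩ := ih
    let ψ := Equiv.ofBijective _ (rotateCons_bijective n)
    refine ⟨(ψ.symm.trans (Equiv.prodCongr (Equiv.refl _) φ)).trans
      (inflationaryMapSuccEquiv n), fun τ => ?_⟩
    obtain ⟨⟨a, t⟩, rfl⟩ := ψ.surjective τ
    have h1 : (ψ.symm.trans (Equiv.prodCongr (Equiv.refl _) φ)).trans
      (inflationaryMapSuccEquiv n) (ψ (a, t)) = inflationaryMapSuccEquiv n (a, φ t) := by simp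
    rw [h1, range_inflationaryMapSuccEquiv, hφ]
    exact (nonAscentBottoms_rotateCons a t).symm

theorem ascentBottoms_subset_iff {n : ℕ} (π τ : Equiv.Perm (Fin n)) :
    ascentBottoms τ ⊆ descentPositions π ↔
      ∀ p q : Fin n, (q : ℕ) = p + 1 → p ∉ nonAscentBottoms τ → π q < π p := by
  constructor
  · intro h p q hpq hp
    obtain ⟨i, rfl⟩ := τ.surjective p
    have : ∃ j : Fin n, (j : ℕ) = i + 1 ∧ τ i ≤ τ j := by
      by_contra! hc
      exact hp ⟨i, rfl, hc⟩
    obtain ⟨j, hj, hij⟩ := this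
    have hne : i ≠ j := by
      rintro rfl
      omega
    obtain ⟨p', q', hp', hq', hlt⟩ :=
      h ⟨i, j, hj, lt_of_le_of_ne hij (τ.injective.ne hne), rfl⟩
    have h1 : p' = τ i := Fin.ext (by omega)
    have h2 : q' = q := Fin.ext (by omega)
    rwa [h1, h2] at hlt
  · rintro h _ ⟨i, j, hj, hij, rfl⟩
    have hlt : (τ i : ℕ) + 1 < n := lt_of_le_of_lt (Nat.succ_le_of_lt hij) (τ j).isLt
    refine ⟨τ i, ⟨τ i + 1, hlt⟩, rfl, rfl, h _ _ rfl ?_⟩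
    rintro ⟨i', hi', hall⟩
    obtain rfl := τ.injective hi'
    exact lt_asymm hij (hall j hj)

/-- The pairs `(π, r)` with `r` inflationary such that `π` has a descent at each position that is
not in the image of `r`. -/
abbrev DescentInflationaryPair (n : ℕ) : Type :=
  {x : Equiv.Perm (Fin n) × InflationaryMap n //
    ∀ p q : Fin n, (q : ℕ) = p + 1 → p ∉ Set.range x.2.1 → x.1 q < x.1 p}

theorem nonempty_ascentDescentPairs_equiv (n : ℕ) :
    Nonempty (ascentDescentPairs n ≃ DescentInflationaryPair n) := by
  obtain ⟨φ, hφ⟩ := exists_perm_equiv_inflationaryMap n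
  refine ⟨(Equiv.prodCongr (Equiv.refl _) φ).subtypeEquiv fun x => ?_⟩
  change ascentBottoms x.2 ⊆ descentPositions x.1 ↔
    ∀ p q : Fin n, (q : ℕ) = p + 1 → p ∉ Set.range (φ x.2).1 → x.1 q < x.1 p
  rw [hφ, ascentBottoms_subset_iff]

/-! ### From pairs to interval orders -/

/-- The interval order in which `π p` is represented by the interval `[p, r p]`. -/
@[reducible]
def intervalOrderOf {n : ℕ} (π : Equiv.Perm (Fin n)) (r : InflationaryMap n) :
    PartialOrder (Fin n) where
  le x y := x = y ∨ r.1 (π.symm x) < π.symm y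
  lt x y := r.1 (π.symm x) < π.symm y
  le_refl x := Or.inl rfl
  le_trans x y z := by
    rintro (rfl | h) (rfl | h')
    · exact Or.inl rfl
    · exact Or.inr h'
    · exact Or.inr h
    · exact Or.inr (h.trans_le ((r.2 _).trans h'.le))
  lt_iff_le_not_ge x y := by
    constructor
    · refine fun h => ⟨Or.inr h, ?_⟩
      rintro (rfl | h')
      · exact (r.2 _).not_gt h
      · exact lt_irrefl _ (h.trans_le ((r.2 _).trans (h'.le.trans (r.2 _))))
    · rintro ⟨rfl | h, h'⟩
      · exact absurd (Or.inl rfl) h'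
      · exact h
  le_antisymm x y := by
    rintro (rfl | h) (h' | h')
    · rfl
    · rfl
    · exact h'.symm
    · exact absurd (h.trans_le ((r.2 _).trans (h'.le.trans (r.2 _)))) (lt_irrefl _)

theorem intervalOrderOf_lt {n : ℕ} (π : Equiv.Perm (Fin n)) (r : InflationaryMap n)
    (p q : Fin n) : (intervalOrderOf π r).lt (π p) (π q) ↔ r.1 p < q := by
  change r.1 (π.symm (π p)) < π.symm (π q) ↔ _
  simp

theorem isIntervalOrder_intervalOrderOf {n : ℕ} (π : Equiv.Perm (Fin n)) (r : InflationaryMap n) :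
    IsIntervalOrder (intervalOrderOf π r) := by
  refine ⟨fun z => ((π.symm z : ℕ) : ℝ), fun z => ((r.1 (π.symm z) : ℕ) : ℝ), fun z => ?_,
    fun x y => ?_⟩
  · exact Nat.cast_le.2 (r.2 _)
  · rw [Nat.cast_lt]
    rfl

open Classical in
/-- The elements `x` that are related to `y`. -/
noncomputable def downFinset {n : ℕ} (R : Fin n → Fin n → Prop) (y : Fin n) : Finset (Fin n) :=
  Finset.univ.filter fun x => R x y

theorem mem_downFinset {n : ℕ} {R : Fin n → Fin n → Prop} {x y : Fin n} :
    x ∈ downFinset R y ↔ R x y := by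
  simp [downFinset]

/-- The key by which the elements are sorted: first by the number of elements below it, then by
decreasing label. -/
noncomputable def sortKey {n : ℕ} (R : Fin n → Fin n → Prop) (y : Fin n) : ℕ ×ₗ (Fin n)ᵒᵈ :=
  toLex ((downFinset R y).card, OrderDual.toDual y)

theorem sortKey_injective {n : ℕ} (R : Fin n → Fin n → Prop) :
    Function.Injective (sortKey R) := fun _ _ h =>
  OrderDual.toDual.injective (congrArg Prod.snd (toLex.injective h))

theorem sortKey_lt_iff {n : ℕ} {R : Fin n → Fin n → Prop} {x y : Fin n} :
    sortKey R x < sortKey R y ↔ (downFinset R x).card < (downFinset R y).card ∨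
      (downFinset R x).card = (downFinset R y).card ∧ y < x := by
  rw [sortKey, sortKey, Prod.Lex.toLex_lt_toLex]
  rfl

theorem strictMono_of_forall_val_succ {n : ℕ} {α : Type*} [Preorder α] {f : Fin n → α}
    (h : ∀ p q : Fin n, (q : ℕ) = p + 1 → f p < f q) : StrictMono f := by
  cases n with
  | zero => exact fun a => a.elim0
  | succ n => exact Fin.strictMono_iff_lt_succ.2 fun i => h _ _ (by simp)

/-- From position `p` to the next, the down-set gains exactly the `π i` with `r i = p`. So its size
grows if `p` is in the image of `r`; otherwise the sizes tie and the required descent decides. -/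
theorem strictMono_sortKey_intervalOrderOf {n : ℕ} (x : DescentInflationaryPair n) :
    StrictMono (sortKey (intervalOrderOf x.1.1 x.1.2).lt ∘ x.1.1) := by
  obtain ⟨⟨π, r⟩, hx⟩ := x
  refine strictMono_of_forall_val_succ fun p q hpq => ?_
  have hlt : p < q := Fin.lt_def.2 (by omega)
  change sortKey (intervalOrderOf π r).lt (π p) < sortKey (intervalOrderOf π r).lt (π q)
  have hsub : downFinset (intervalOrderOf π r).lt (π p) ⊆
      downFinset (intervalOrderOf π r).lt (π q) := by
    intro z hz
    obtain ⟨i, rfl⟩ := π.surjective z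
    rw [mem_downFinset, intervalOrderOf_lt] at hz ⊢
    exact hz.trans hlt
  rw [sortKey_lt_iff]
  by_cases hp : p ∈ Set.range r.1
  · left
    obtain ⟨i, hi⟩ := hp
    refine Finset.card_lt_card ((Finset.ssubset_iff_of_subset hsub).2 ⟨π i, ?_, ?_⟩)
    · rw [mem_downFinset, intervalOrderOf_lt, hi]
      exact hlt
    · rw [mem_downFinset, intervalOrderOf_lt, hi]
      exact lt_irrefl _
  · rcases (Finset.card_le_card hsub).lt_or_eq with h | h
    · exact Or.inl h
    · exact Or.inr ⟨h, hx p q hpq hp⟩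

theorem intervalOrderOf_injective {n : ℕ} {x y : DescentInflationaryPair n}
    (h : intervalOrderOf x.1.1 x.1.2 = intervalOrderOf y.1.1 y.1.2) : x = y := by
  have hx := strictMono_sortKey_intervalOrderOf x
  have hy := strictMono_sortKey_intervalOrderOf y
  rw [← h] at hy
  have hπ : x.1.1 = y.1.1 := by
    have hr := (hx.range_inj hy).1 (by
      rw [Set.range_comp, Set.range_comp, x.1.1.surjective.range_eq, y.1.1.surjective.range_eq])
    ext1 p
    exact sortKey_injective _ (congrFun hr p)
  have hr : x.1.2 = y.1.2 := by
    apply Subtype.ext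
    funext p
    refine eq_of_forall_gt_iff fun q => ?_
    rw [← intervalOrderOf_lt x.1.1, h, hπ, intervalOrderOf_lt]
  exact Subtype.ext (Prod.ext hπ hr)

/-! ### From interval orders to pairs -/

/-- Down-sets grow with the left endpoint, hence form a chain, on which cardinality detects
inclusion. -/
theorem downFinset_subset_of_card_le {n : ℕ} {R : Fin n → Fin n → Prop} {l r : Fin n → ℝ}
    (hR : ∀ x y, R x y ↔ r x < l y) {y z : Fin n}
    (h : (downFinset R y).card ≤ (downFinset R z).card) : downFinset R y ⊆ downFinset R z := by
  have hmono : ∀ {y z}, l y ≤ l z → downFinset R y ⊆ downFinset R z := by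
    intro y z hyz x hx
    rw [mem_downFinset, hR] at hx ⊢
    exact hx.trans_le hyz
  rcases le_total (l y) (l z) with hyz | hzy
  · exact hmono hyz
  · exact (Finset.eq_of_subset_of_card_le (hmono hzy) h).symm.subset

theorem exists_intervalOrderOf_lt_iff {n : ℕ} {R : Fin n → Fin n → Prop} {l u : Fin n → ℝ}
    (hlu : ∀ z, l z ≤ u z) (hR : ∀ x y, R x y ↔ u x < l y) :
    ∃ x : DescentInflationaryPair n, ∀ a b, (intervalOrderOf x.1.1 x.1.2).lt a b ↔ R a b := by
  classical
  let π := Tuple.sort (sortKey R)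
  have hmono : Monotone (sortKey R ∘ π) := Tuple.monotone_sort _
  have hstrict : StrictMono (sortKey R ∘ π) :=
    hmono.strictMono_of_injective ((sortKey_injective R).comp π.injective)
  have hsub : ∀ {q q'}, q ≤ q' → downFinset R (π q) ⊆ downFinset R (π q') := fun hq =>
    downFinset_subset_of_card_le hR ((Prod.Lex.le_iff'.1 (hmono hq)).1)
  have hirr : ∀ p, ¬ R (π p) (π p) := fun p => fun h => ((hR _ _).1 h).not_ge (hlu _)
  -- `r p` will be the last position whose label is not above `π p`; `p` itself qualifies, so `r` is
  -- inflationary.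
  let s : Fin n → Finset (Fin n) := fun p => Finset.univ.filter fun q => ¬ R (π p) (π q)
  have hs : ∀ p, p ∈ s p := fun p => by simp [s, hirr p]
  let r : Fin n → Fin n := fun p => (s p).max' ⟨p, hs p⟩
  have hr : ∀ p q, r p < q ↔ R (π p) (π q) := by
    intro p q
    constructor
    · intro h
      by_contra hc
      exact h.not_ge ((s p).le_max' q (by simp [s, hc]))
    · intro h
      have hmem : r p ∈ s p := (s p).max'_mem _
      by_contra hc
      have := hsub (not_lt.1 hc) (mem_downFinset.2 h)
      rw [mem_downFinset] at this
      simp [s, this] at hmem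
  refine ⟨⟨(π, ⟨r, fun p => (s p).le_max' p (hs p)⟩), fun p q hpq hp => ?_⟩, ?_⟩
  · have hlt : p < q := Fin.lt_def.2 (by omega)
    -- As no `r i` equals `p`, `r i < p + 1` already forces `r i < p`; with equal down-sets, the
    -- tie-break gives the descent.
    have heq : downFinset R (π p) = downFinset R (π q) := by
      refine (hsub hlt.le).antisymm fun z hz => ?_
      obtain ⟨i, rfl⟩ := π.surjective z
      rw [mem_downFinset, ← hr] at hz ⊢
      have hne : r i ≠ p := fun h => hp ⟨i, h⟩
      rw [Fin.lt_def] at hz ⊢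
      rw [Ne, Fin.ext_iff] at hne
      omega
    rcases sortKey_lt_iff.1 (hstrict hlt) with h | h
    · rw [heq] at h
      exact absurd h (lt_irrefl _)
    · exact h.2
  · intro x y
    obtain ⟨p, rfl⟩ := π.surjective x
    obtain ⟨q, rfl⟩ := π.surjective y
    rw [intervalOrderOf_lt, hr]

theorem IsIntervalOrder.exists_eq_intervalOrderOf {n : ℕ} {P : PartialOrder (Fin n)}
    (hP : IsIntervalOrder P) :
    ∃ x : DescentInflationaryPair n, intervalOrderOf x.1.1 x.1.2 = P := by
  obtain ⟨l, u, hlu, hR⟩ := hP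
  obtain ⟨x, hx⟩ := exists_intervalOrderOf_lt_iff hlu hR
  refine ⟨x, PartialOrder.ext fun a b => ?_⟩
  rw [@le_iff_eq_or_lt _ (intervalOrderOf _ _), @le_iff_eq_or_lt _ P]
  exact or_congr Iff.rfl (hx a b)

theorem nonempty_labeledIntervalOrder_equiv (n : ℕ) :
    Nonempty (DescentInflationaryPair n ≃ LabeledIntervalOrder n) := by
  refine ⟨Equiv.ofBijective
    (fun x => ⟨intervalOrderOf x.1.1 x.1.2, isIntervalOrder_intervalOrderOf _ _⟩)
    ⟨fun x y h => intervalOrderOf_injective (congrArg Subtype.val h), fun P => ?_⟩⟩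
  obtain ⟨x, hx⟩ := P.2.exists_eq_intervalOrderOf
  exact ⟨x, Subtype.ext hx⟩

theorem descentPositions_subset {n : ℕ} (π : Equiv.Perm (Fin n)) :
    descentPositions π ⊆ Set.Icc 1 (n - 1) := by
  rintro i ⟨p, q, hp, hq, -⟩
  have := q.isLt
  rw [Set.mem_Icc]
  omega

theorem BetaKappa.toPair_injective (n : ℕ) : Function.Injective (BetaKappa.toPair (n := n)) := by
  rintro ⟨⟨S, hS⟩, ⟨π, hπ⟩, ⟨τ, hτ⟩⟩ ⟨⟨S', hS'⟩, ⟨π', hπ'⟩, ⟨τ', hτ'⟩⟩ h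
  obtain ⟨rfl, rfl⟩ : π = π' ∧ τ = τ' := ⟨congrArg Prod.fst h, congrArg Prod.snd h⟩
  obtain rfl : S = S' := Eq.trans (Eq.symm hπ) hπ'
  rfl

theorem BetaKappa.range_toPair (n : ℕ) :
    Set.range (BetaKappa.toPair (n := n)) = ascentDescentPairs n := by
  ext ⟨π, τ⟩
  constructor
  · rintro ⟨⟨⟨S, hS⟩, ⟨π', hπ⟩, ⟨τ', hτ⟩⟩, h⟩
    obtain ⟨rfl, rfl⟩ : π' = π ∧ τ' = τ := ⟨congrArg Prod.fst h, congrArg Prod.snd h⟩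
    exact Set.Subset.trans hτ (Eq.symm hπ).subset
  · intro h
    exact ⟨⟨⟨descentPositions π, descentPositions_subset π⟩, ⟨π, rfl⟩, ⟨τ, h⟩⟩, rfl⟩

theorem mainTheorem1 (n : ℕ) :
    Nonempty (LabeledIntervalOrder n ≃ BetaKappa n) ∧
    (Function.Injective (BetaKappa.toPair (n := n)) ∧
      Set.range (BetaKappa.toPair (n := n)) = ascentDescentPairs n) ∧
    Nonempty (LabeledIntervalOrder n ≃ ascentDescentPairs n) := by
  obtain ⟨e⟩ := nonempty_ascentDescentPairs_equiv n
  obtain ⟨f⟩ := nonempty_labeledIntervalOrder_equiv n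
  let g : LabeledIntervalOrder n ≃ ascentDescentPairs n := (e.trans f).symm
  let t : BetaKappa n ≃ ascentDescentPairs n :=
    (Equiv.ofInjective _ (BetaKappa.toPair_injective n)).trans
      (Equiv.setCongr (BetaKappa.range_toPair n))
  exact ⟨⟨g.trans t.symm⟩, ⟨BetaKappa.toPair_injective n, BetaKappa.range_toPair n⟩, ⟨g⟩⟩
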